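/- For probability measures $\mu_1,\mu_2$ on $\mathbb R$, put $G_\mu(z)=\int_{\mathbb R}\frac{\mu(dt)}{z-t}$ and $F_\mu=1/G_\mu$ on the upper half plane $\mathbb C^+$. Let $\mathcal F$ be the class of reciprocal Cauchy transforms $F_\mu$ of probability measures $\mu$ on $\mathbb R$; equivalently, of the analytic functions $f:\mathbb C^+\to\mathbb C^+\cup\mathbb R$ with $f(z)/z\to1$ as $z\to\infty$ nontangentially. The free additive convolution $\mu_1\boxplus\mu_2$ is the unique probability measure $\nu$ such that $F_\nu(z)=F_{\mu_1}(Z_1(z))$ on $\mathbb C^+$ for some $Z_1,Z_2\in\mathcal F$ with $z=Z_1(z)+Z_2(z)-F_{\mu_1}(Z_1(z))$ and $F_{\mu_1}(Z_1(z))=F_{\mu_2}(Z_2(z))$ for all $z\in\mathbb C^+$; write $\mu^{n\boxplus}=\mu\boxplus\cdots\boxplus\mu$ ($n$ times). Let $\mu_w$ be the semicircle law with density $\frac1{2\pi}\sqrt{(4-x^2)_+}$, and define the Kolmogorov and Lévy distances by $$\Delta(\mu,\nu)=\sup_{x\in\mathbb R}|\mu((-\infty,x))-\nu((-\infty,x))|,$$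 $$L(\mu,\nu)=\inf\{h:\ \mu((-\infty,x-h))-h\le\nu((-\infty,x))\le\mu((-\infty,x+h))+h\ \text{ for all }x\in\mathbb R\}.$$ **Proposition.** Let $0<p<1$, $q=1-p$ and $p\ne q$. There is a constant $c(p)>0$, depending only on $p$, with the following property. Let $\mu$ be a probability measure on $\mathbb R$ with $\mu(\{-\sqrt{p/q}\})=q$ and $\mu(\{\sqrt{q/p}\})=p$, and let $\mu_n$ be given by $\mu_n((-\infty,x))=\mu((-\infty,x\sqrt{m_2(\mu)\,n}))$, where $m_2(\mu)=\int u^2\,\mu(du)$ (which equals $1$ here). Then for every integer $n\ge1$ $$\Delta(\mu_n^{n\boxplus},\mu_w)\ \ge\ L(\mu_n^{n\boxplus},\mu_w)\ \ge\ \frac{c(p)}{\sqrt n}.$$ -/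

import Mathlib

namespace FreeProb

open MeasureTheory

noncomputable section

/-- The open upper half plane `ℂ⁺`. -/
def upperHalf : Set ℂ := {z | 0 < z.im}

/-- The cone `Γ_α = {z = x + iy ∈ ℂ⁺ : |x| < α y}`. -/
def cone (α : ℝ) : Set ℂ := {z | 0 < z.im ∧ |z.re| < α * z.im}

/-- The Cauchy transform `G_μ(z) = ∫ μ(dt) / (z - t)`, used for `z ∈ ℂ⁺`. -/
def cauchyTransform (μ : ProbabilityMeasure ℝ) (z : ℂ) : ℂ :=
  ∫ t : ℝ, 1 / (z - (t : ℂ)) ∂(μ : Measure ℝ)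

/-- The reciprocal Cauchy transform `F_μ = 1 / G_μ` (`G_μ` has no zeros in `ℂ⁺`). -/
def recipCauchy (μ : ProbabilityMeasure ℝ) (z : ℂ) : ℂ := 1 / cauchyTransform μ z

/-- The class `𝓕` of reciprocal Cauchy transforms of probability measures, described as the
Nevanlinna functions `f : ℂ⁺ → ℂ⁺ ∪ ℝ` (analytic) such that `f(z)/z → 1` as `z → ∞`
nontangentially, i.e. within each cone `Γ_α`. -/
structure ClassF (f : ℂ → ℂ) : Prop where
  analytic : DifferentiableOn ℂ f upperHalf
  im_nonneg : ∀ z ∈ upperHalf, 0 ≤ (f z).im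
  nontangential : ∀ α : ℝ, 0 < α →
    Filter.Tendsto (fun z => f z / z) (Bornology.cobounded ℂ ⊓ Filter.principal (cone α)) (nhds 1)

/-- `ν` is the free additive convolution of `μ₁` and `μ₂`: there are subordination functions
`Z₁, Z₂ ∈ 𝓕` with `z = Z₁ + Z₂ - F_{μ₁}(Z₁)` and `F_{μ₁}(Z₁) = F_{μ₂}(Z₂)` on `ℂ⁺`, and
`F_ν = F_{μ₁}(Z₁)` there. -/
def IsFreeConv (μ₁ μ₂ ν : ProbabilityMeasure ℝ) : Prop :=
  ∃ Z₁ Z₂ : ℂ → ℂ, ClassF Z₁ ∧ ClassF Z₂ ∧ ∀ z ∈ upperHalf,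
    z = Z₁ z + Z₂ z - recipCauchy μ₁ (Z₁ z) ∧
    recipCauchy μ₁ (Z₁ z) = recipCauchy μ₂ (Z₂ z) ∧
    recipCauchy ν z = recipCauchy μ₁ (Z₁ z)

instance : Nonempty (ProbabilityMeasure ℝ) := ⟨⟨Measure.dirac 0, inferInstance⟩⟩

/-- The free additive convolution `μ₁ ⊞ μ₂`: the (unique) probability measure singled out by
`IsFreeConv`. -/
def freeConv (μ₁ μ₂ : ProbabilityMeasure ℝ) : ProbabilityMeasure ℝ :=
  Classical.epsilon (IsFreeConv μ₁ μ₂)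

/-- The `n`-fold free convolution `μ ⊞ ⋯ ⊞ μ`; the empty one is the unit `δ₀`. -/
def freePow (μ : ProbabilityMeasure ℝ) : ℕ → ProbabilityMeasure ℝ
  | 0 => ⟨Measure.dirac 0, inferInstance⟩
  | 1 => μ
  | n + 2 => freeConv (freePow μ (n + 1)) μ

/-- The second moment `m₂(μ)`. -/
def secondMoment (μ : ProbabilityMeasure ℝ) : ℝ := ∫ u : ℝ, u ^ 2 ∂(μ : Measure ℝ)

/-- The rescaled measure `μ_n`, with `μ_n((-∞, x)) = μ((-∞, x √(m₂(μ) n)))`: the image of `μ`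
under division by `√(m₂(μ) n)`. -/
def rescale (μ : ProbabilityMeasure ℝ) (n : ℕ) : ProbabilityMeasure ℝ :=
  μ.map (f := fun t : ℝ => t / Real.sqrt (secondMoment μ * n))
    (measurable_id.div_const _).aemeasurable

/-- The semicircle law, with density `(2π)⁻¹ √((4 - x²)₊)`. -/
def semicircle : Measure ℝ :=
  volume.withDensity
    (fun x : ℝ => ENNReal.ofReal (1 / (2 * Real.pi) * Real.sqrt (max (4 - x ^ 2) 0)))

/-- The Kolmogorov distance `Δ(μ, ν)`. -/
def kolmogorovDist (μ ν : Measure ℝ) : ℝ :=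
  ⨆ x : ℝ, |μ.real (Set.Iio x) - ν.real (Set.Iio x)|

/-- The Lévy distance `L(μ, ν)`. -/
def levyDist (μ ν : Measure ℝ) : ℝ :=
  sInf {h : ℝ | ∀ x : ℝ, μ.real (Set.Iio (x - h)) - h ≤ ν.real (Set.Iio x) ∧
    ν.real (Set.Iio x) ≤ μ.real (Set.Iio (x + h)) + h}

end

end FreeProb

/-!
Standardize the two-point law: with `s = √(q/p) - √(p/q)` its reciprocal Cauchy transform is
`F(z) = z - 1 / (z - s)`, and after rescaling by `√n` it is `z - v / (z - σ)` with `v = 1 / n`,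
`σ = s / √n`. The subordination equations for its free powers are then quadratic, and by induction
the `k`-fold power has `F(z) = z - k v / w`, where `w` is the root of `w + (k - 1) v / w = z - σ` in
the upper half plane (`IsFreeBinomial`, `isFreeBinomial_freePow`).

Since `freeConv` is a choice, each step of this induction needs both the uniqueness of the solution
(`IsFreeBinomial.of_isFreeConv`) and its existence (`IsFreeBinomial.exists_isFreeConv`). For the
latter, a measure with the required `F` is obtained as the spectral measure, at the first basis
vector, of a Jacobi operator on `ℓ²(ℕ)` whose coefficients are constant after the first ones
(`jacobiOp`); its resolvent vector is essentially a geometric sequence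
(`exists_jacobiOp_resolvent`).

For `k = n` and at the point `z = i`, the equation for `w` shows that the Cauchy transform of the
`n`-fold power has a real part of order `|s| / √n` (`abs_re_cauchyTransform_I_ge`), whereas that of
the semicircle law is purely imaginary by symmetry. The difference of these real parts is the
difference of the integrals of `t / (1 + t²)`, which integration by parts bounds by `π` times the
Kolmogorov distance (`abs_integral_sub_integral_le`); and this in turn is at most twice the Lévy
distance, because the semicircle law has density at most `1` (`abs_sub_semicircle_le`). Finally
`s ≠ 0` because `p ≠ q`.
-/

open MeasureTheory Filter Topology
open scoped CompactlySupported

namespace FreeProb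

/-! ### The spectral measure of a self-adjoint operator at a vector -/

section SpectralMeasure

variable {H : Type*} [NormedAddCommGroup H] [InnerProductSpace ℂ H] [CompleteSpace H]

/-- The spectral measure of `T` at `e`: `f ↦ ⟪e, f(T) e⟫` is a positive functional on the continuous
functions on the spectrum, hence given by a measure (Riesz–Markov–Kakutani). -/
theorem exists_measure_integral_eq_cfcHom (T : H →L[ℂ] H) (hT : IsSelfAdjoint T) (e : H) :
    ∃ ν : Measure (spectrum ℝ T), IsFiniteMeasure ν ∧ ∀ f : C(spectrum ℝ T, ℝ),
      ((∫ t, f t ∂ν : ℝ) : ℂ) = inner ℂ e (cfcHom (R := ℝ) hT f e) := by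
  have hc : CompactSpace (spectrum ℝ T) := isCompact_iff_compactSpace.mp (spectrum.isCompact T)
  let Λ₀ : C_c(spectrum ℝ T, ℝ) →ₗ[ℝ] ℝ :=
    { toFun := fun f => (inner ℂ e (cfcHom (R := ℝ) hT (f : C(spectrum ℝ T, ℝ)) e)).re
      map_add' := fun f g => by
        have : ((f + g : C_c(spectrum ℝ T, ℝ)) : C(spectrum ℝ T, ℝ)) =
            (f : C(spectrum ℝ T, ℝ)) + g := rfl
        rw [this, map_add, add_apply, inner_add_right, Complex.add_re]
      map_smul' := fun c f => by
        have : ((c • f : C_c(spectrum ℝ T, ℝ)) : C(spectrum ℝ T, ℝ)) =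
            c • (f : C(spectrum ℝ T, ℝ)) := rfl
        rw [this, map_smul, smul_apply]
        simp [inner_smul_right_eq_smul] }
  let Λ : C_c(spectrum ℝ T, ℝ) →ₚ[ℝ] ℝ := PositiveLinearMap.mk₀ Λ₀ (fun f hf => by
    have h1 : 0 ≤ cfcHom (R := ℝ) hT (f : C(spectrum ℝ T, ℝ)) := by
      rw [cfcHom_nonneg_iff]
      exact fun t => hf t
    have h2 := (ContinuousLinearMap.nonneg_iff_isPositive _).1 h1
    exact h2.re_inner_nonneg_right e)
  refine ⟨RealRMK.rieszMeasure Λ, inferInstance, fun f => ?_⟩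
  have h := RealRMK.integral_rieszMeasure Λ (CompactlySupportedContinuousMap.continuousMapEquiv f)
  have h' : ∫ t, f t ∂(RealRMK.rieszMeasure Λ) = (inner ℂ e (cfcHom (R := ℝ) hT f e)).re := h
  rw [h']
  have hs : IsSelfAdjoint (cfcHom (R := ℝ) hT f) := cfcHom_predicate hT f
  exact hs.isSymmetric.coe_re_inner_self_apply e

/-- The diagonal resolvent entry `⟪e, (z - T)⁻¹ e⟫` of a self-adjoint operator at a unit vector is
the Cauchy transform of a probability measure. The resolvent enters only through a solution `x` of
`z x - T x = e`, so that no inverse has to be formed. -/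
theorem exists_probabilityMeasure_cauchyTransform_eq_inner (T : H →L[ℂ] H) (hT : IsSelfAdjoint T)
    (e : H) (he : ‖e‖ = 1) :
    ∃ ν : ProbabilityMeasure ℝ, ∀ (z : ℂ) (x : H), 0 < z.im → z • x - T x = e →
      cauchyTransform ν z = inner ℂ e x := by
  obtain ⟨ν, hfin, hν⟩ := exists_measure_integral_eq_cfcHom T hT e
  have hone : ν Set.univ = 1 := by
    have h := hν 1
    rw [map_one] at h
    simp [inner_self_eq_norm_sq_to_K, he] at h
    have h' : ν.real Set.univ = 1 := by exact_mod_cast h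
    rw [measureReal_def] at h'
    rw [← ENNReal.ofReal_toReal (measure_ne_top ν Set.univ), h', ENNReal.ofReal_one]
  have hp : IsProbabilityMeasure ν := ⟨hone⟩
  have hc : CompactSpace (spectrum ℝ T) := isCompact_iff_compactSpace.mp (spectrum.isCompact T)
  refine ⟨⟨ν.map Subtype.val, Measure.isProbabilityMeasure_map (by fun_prop)⟩, fun z x hz hx => ?_⟩
  have hpos : ∀ t : ℝ, (z.re - t) ^ 2 + z.im ^ 2 ≠ 0 := fun t => by positivity
  let ι : C(spectrum ℝ T, ℝ) := (ContinuousMap.id ℝ).restrict (spectrum ℝ T)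
  let d : C(spectrum ℝ T, ℝ) :=
    ⟨fun t => ((z.re - t) ^ 2 + z.im ^ 2)⁻¹, by
      apply Continuous.inv₀ (by fun_prop); exact fun t => hpos t⟩
  have hι : cfcHom (R := ℝ) hT ι = T := cfcHom_id hT
  set Φ := cfcHom (R := ℝ) hT with hΦ
  -- `1 / (z - t) = g t - i (Im z) d t`, with `g` and `d` the real functions
  -- `(Re z - t) / |z - t|²` and `1 / |z - t|²`.
  let g : C(spectrum ℝ T, ℝ) := d * (algebraMap ℝ _ z.re - ι)
  have hdg : g * (algebraMap ℝ _ z.re - ι) + d * algebraMap ℝ _ (z.im ^ 2) = 1 := by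
    ext t
    have := hpos t
    simp [g, d, ι]
    field_simp
  have hTg : ∀ y : H, Φ g y = Φ d ((z.re : ℂ) • y - T y) := fun y => by
    simp only [g, map_mul, map_sub, hι, AlgHomClass.commutes, mul_apply_eq_comp]
    rw [← map_sub]
    rfl
  have hTdg : ∀ y : H, Φ g ((z.re : ℂ) • y - T y) + Φ d ((z.im ^ 2 : ℂ) • y) = y := fun y => by
    have h := congrArg (fun f => Φ f y) hdg
    simp only [map_add, map_mul, map_sub, hι, AlgHomClass.commutes, map_one, add_apply,
      mul_apply_eq_comp, one_apply_eq_self] at h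
    convert! h using 3
    norm_cast
  have hxe : x = Φ g e - (Complex.I * z.im) • Φ d e := by
    have hxx : (z.re : ℂ) • x - T x = e - (Complex.I * z.im) • x := by
      rw [← hx]
      nth_rewrite 2 [← Complex.re_add_im z]
      module
    have h1 := hTdg x
    rw [hxx, map_sub, map_smul, map_smul, hTg x, hxx, map_sub, map_smul] at h1
    rw [← h1]
    have : (Complex.I * z.im) * (Complex.I * z.im) = - (z.im ^ 2 : ℂ) := by
      linear_combination (z.im : ℂ) ^ 2 * Complex.I_mul_I
    simp only [smul_sub, smul_smul, this]
    module
  have hint : ∀ f : C(spectrum ℝ T, ℝ), Integrable (fun t => ((f t : ℝ) : ℂ)) ν := fun f =>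
    (BoundedContinuousFunction.integrable ν (BoundedContinuousFunction.mkOfCompact f)).ofReal
  have hfun : ∀ t : spectrum ℝ T, 1 / (z - ((t : ℝ) : ℂ)) =
      (g t : ℂ) - (Complex.I * z.im) * (d t : ℂ) := fun t => by
    have hne : z - ((t : ℝ) : ℂ) ≠ 0 := fun h => by
      have := congrArg Complex.im h
      simp at this
      exact hz.ne' this
    have h2 : (((z.re - t) ^ 2 + z.im ^ 2 : ℝ) : ℂ) ≠ 0 := by exact_mod_cast hpos t
    rw [div_eq_iff hne]
    simp only [g, d, ι, ContinuousMap.mul_apply, ContinuousMap.coe_mk, ContinuousMap.sub_apply]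
    push_cast at h2 ⊢
    simp
    field_simp
    obtain ⟨a, b⟩ := z
    rw [Complex.mk_eq_add_mul_I]
    simp
    linear_combination (b : ℂ) ^ 2 * Complex.I_mul_I
  calc cauchyTransform _ z = ∫ t : spectrum ℝ T, 1 / (z - ((t : ℝ) : ℂ)) ∂ν := by
        unfold cauchyTransform
        exact integral_map (by fun_prop) (by
          apply Measurable.aestronglyMeasurable; fun_prop)
    _ = ∫ t, ((g t : ℂ) - (Complex.I * z.im) * (d t : ℂ)) ∂ν := by simp only [hfun]
    _ = inner ℂ e x := by
        rw [integral_sub (hint g) ((hint d).const_mul _), integral_const_mul,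
          integral_complex_ofReal, integral_complex_ofReal, hν, hν, hxe, inner_sub_right, inner_smul_right]

end SpectralMeasure

/-! ### A Jacobi operator whose resolvent entry is explicit -/

section JacobiOperator

/-- The unilateral shift on `ℓ²(ℕ)` and the first basis vector. -/
theorem exists_shift : ∃ (S : lp (fun _ : ℕ => ℂ) 2 →ₗᵢ[ℂ] lp (fun _ : ℕ => ℂ) 2)
    (e : lp (fun _ : ℕ => ℂ) 2), ‖e‖ = 1 ∧ ∀ x, inner ℂ e (S x) = 0 := by
  let V : ∀ _ : ℕ, ℂ →ₗᵢ[ℂ] lp (fun _ : ℕ => ℂ) 2 := fun i =>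
    { toLinearMap := lp.lsingle (𝕜 := ℂ) (E := fun _ : ℕ => ℂ) 2 (i + 1)
      norm_map' := fun x => by
        change ‖lp.single (E := fun _ : ℕ => ℂ) 2 (i + 1) x‖ = ‖x‖
        exact lp.norm_single (by norm_num) _ _ }
  have hV : OrthogonalFamily ℂ (fun _ : ℕ => ℂ) V := fun i j hij a b => by
    change inner ℂ (lp.single (E := fun _ : ℕ => ℂ) 2 (i + 1) a) (lp.single 2 (j + 1) b) = 0
    rw [lp.inner_single_left, lp.single_apply_ne _ _ _ (by omega), inner_zero_right]
  refine ⟨hV.linearIsometry, lp.single 2 0 1, ?_, fun x => ?_⟩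
  · rw [lp.norm_single (by norm_num)]
    simp
  · have h := (hV.hasSum_linearIsometry x).mapL
      (innerSL ℂ (lp.single (E := fun _ : ℕ => ℂ) 2 0 1))
    refine h.unique ?_
    convert! hasSum_zero with i
    change inner ℂ (lp.single (E := fun _ : ℕ => ℂ) 2 0 1) (lp.single 2 (i + 1) (x i)) = 0
    rw [lp.inner_single_left, lp.single_apply_ne _ _ _ (by omega), inner_zero_right]

variable {H : Type*} [NormedAddCommGroup H] [InnerProductSpace ℂ H] [CompleteSpace H]

/-- The Jacobi operator with diagonal `0, s, s, …` and off-diagonal `b, √c, √c, …` in the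
orthonormal family `e, S e, S² e, …` generated by an isometry `S` whose range is orthogonal to the
unit vector `e`. It is written as `A + A*`, which makes self-adjointness immediate; half of the
diagonal sits in `A`. -/
noncomputable def jacobiOp (S : H →ₗᵢ[ℂ] H) (e : H) (s c b : ℝ) : H →L[ℂ] H :=
  let A : H →L[ℂ] H := (Real.sqrt c : ℂ) • S.toContinuousLinearMap +
    (s / 2 : ℂ) • (1 - InnerProductSpace.rankOne ℂ e e) +
    (b - Real.sqrt c : ℂ) • InnerProductSpace.rankOne ℂ (S e) e
  A + ContinuousLinearMap.adjoint A

theorem jacobiOp_apply (S : H →ₗᵢ[ℂ] H) (e : H) (s c b : ℝ) (x : H) :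
    jacobiOp S e s c b x =
      (Real.sqrt c : ℂ) • (S x + ContinuousLinearMap.adjoint S.toContinuousLinearMap x) +
      (s : ℂ) • (x - inner ℂ e x • e) +
      (b - Real.sqrt c : ℂ) • (inner ℂ e x • S e + inner ℂ (S e) x • e) := by
  have h1 : ContinuousLinearMap.adjoint (1 : H →L[ℂ] H) = 1 := star_one (H →L[ℂ] H)
  simp only [jacobiOp, map_add, map_sub, map_smulₛₗ, InnerProductSpace.adjoint_rankOne, h1,
    add_apply, sub_apply, smul_apply, one_apply_eq_self, InnerProductSpace.rankOne_apply,
    LinearIsometry.coe_toContinuousLinearMap, Complex.conj_ofReal, map_div₀, Complex.conj_ofNat]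
  module

theorem isSelfAdjoint_jacobiOp (S : H →ₗᵢ[ℂ] H) (e : H) (s c b : ℝ) :
    IsSelfAdjoint (jacobiOp S e s c b) := IsSelfAdjoint.add_star_self _

/-- The resolvent vector is supported on `e` and on `S u`, where `u = ∑ rʲ Sʲ e` is geometric with
ratio `r = √c / w`; the condition `w + c / w = z - s` says that `S u` solves the recursion away from
its first entries. -/
theorem exists_jacobiOp_resolvent (S : H →ₗᵢ[ℂ] H) (e : H) (he : ‖e‖ = 1)
    (hS : ∀ x, inner ℂ e (S x) = 0) {s c b : ℝ} (hc : 0 < c) {z w : ℂ} (hcw : c < ‖w‖ ^ 2)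
    (hw : w + c / w = z - s) (hz : z - b ^ 2 / w ≠ 0) :
    ∃ x, z • x - jacobiOp S e s c b x = e ∧ inner ℂ e x = 1 / (z - b ^ 2 / w) := by
  set Sd := ContinuousLinearMap.adjoint S.toContinuousLinearMap with hSd
  have hw0 : w ≠ 0 := by
    rintro rfl
    simp at hcw
    linarith
  have hsq : (Real.sqrt c : ℂ) * Real.sqrt c = c := by exact_mod_cast Real.mul_self_sqrt hc.le
  set r : ℂ := Real.sqrt c / w with hr
  have hr1 : ‖r‖ < 1 := by
    rw [hr, norm_div, div_lt_one (norm_pos_iff.2 hw0)]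
    simp only [Complex.norm_real, Real.norm_eq_abs, abs_of_nonneg (Real.sqrt_nonneg c)]
    exact Real.sqrt_lt_sqrt hc.le hcw |>.trans_eq (Real.sqrt_sq (norm_nonneg _))
  -- `u = (1 - r S)⁻¹ e`
  obtain ⟨u, hu⟩ : ∃ u : H, u = e + r • S u := by
    have hn : ‖r • S.toContinuousLinearMap‖ < 1 := by
      rw [norm_smul]
      calc ‖r‖ * ‖S.toContinuousLinearMap‖ ≤ ‖r‖ * 1 :=
            mul_le_mul_of_nonneg_left S.norm_toContinuousLinearMap_le (norm_nonneg _)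
        _ < 1 := by simpa using hr1
    obtain ⟨U, hU⟩ := isUnit_one_sub_of_norm_lt_one hn
    refine ⟨U⁻¹.1 e, ?_⟩
    have h : (U.1 * U⁻¹.1) e = e := by simp
    rw [mul_apply_eq_comp, hU] at h
    simp only [sub_apply, one_apply_eq_self, smul_apply,
      LinearIsometry.coe_toContinuousLinearMap] at h
    exact sub_eq_iff_eq_add.1 h
  have hSdS : ∀ x, Sd (S x) = x := fun x => by
    refine ext_inner_left ℂ fun y => ?_
    rw [hSd, ContinuousLinearMap.adjoint_inner_right]
    exact S.inner_map_map y x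
  have hSde : Sd e = 0 := by
    refine ext_inner_left ℂ fun y => ?_
    rw [hSd, ContinuousLinearMap.adjoint_inner_right, inner_zero_right]
    rw [← inner_conj_symm]
    simp [hS]
  have hee : inner ℂ e e = (1 : ℂ) := by simp [inner_self_eq_norm_sq_to_K, he]
  have heu : inner ℂ e u = (1 : ℂ) := by
    rw [hu, inner_add_right, inner_smul_right, hS, hee]; simp
  have hSee : inner ℂ (S e) e = (0 : ℂ) := by
    rw [← inner_conj_symm, hS]; simp
  have hTe : jacobiOp S e s c b e = (b : ℂ) • S e := by
    rw [jacobiOp_apply, ← hSd, hSde, hee, hSee]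
    module
  have hSS : (Real.sqrt c : ℂ) • S (S u) = w • S u - w • S e := by
    have h : S u = S e + r • S (S u) := by
      nth_rewrite 1 [hu]
      rw [map_add, map_smul]
    have h2 : (Real.sqrt c : ℂ) = w * r := by rw [hr]; field_simp
    rw [h2, mul_smul]
    nth_rewrite 2 [h]
    module
  have hcu : (Real.sqrt c : ℂ) • u = (Real.sqrt c : ℂ) • e + (c / w : ℂ) • S u := by
    nth_rewrite 1 [hu]
    rw [smul_add, smul_smul, hr, ← mul_div_assoc, hsq]
  have hTu : jacobiOp S e s c b (S u) = z • S u - w • S e + (b : ℂ) • e := by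
    rw [jacobiOp_apply, ← hSd, hSdS, hS, S.inner_map_map, heu, smul_add, hSS, hcu,
      show z = w + c / w + s by rw [hw]; ring]
    module
  refine ⟨(1 / (z - b ^ 2 / w)) • (e + (b / w : ℂ) • S u), ?_, ?_⟩
  · rw [map_smul, smul_comm, ← smul_sub, map_add, map_smul, hTe, hTu]
    have : z • (e + (b / w : ℂ) • S u) - ((b : ℂ) • S e +
        (b / w : ℂ) • (z • S u - w • S e + (b : ℂ) • e)) = (z - b ^ 2 / w) • e := by
      have : (b / w : ℂ) • w • S e = (b : ℂ) • S e := by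
        rw [smul_smul]; congr 1; field_simp
      simp only [smul_add, smul_sub, this]
      module
    rw [this, smul_smul, one_div, inv_mul_cancel₀ hz, one_smul]
  · rw [inner_smul_right, inner_add_right, inner_smul_right, hS, hee]
    simp

/-- There is a probability measure whose reciprocal Cauchy transform is `z - b² / w`, where `w` is
the root of `w + c / w = z - s` in the upper half plane. -/
theorem exists_recipCauchy_eq {s c b : ℝ} (hc : 0 < c) : ∃ ν : ProbabilityMeasure ℝ,
    ∀ z w : ℂ, 0 < z.im → 0 < w.im → w + c / w = z - s →
      recipCauchy ν z = z - b ^ 2 / w := by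
  obtain ⟨S, e, he, hS⟩ := exists_shift
  obtain ⟨ν, hν⟩ := exists_probabilityMeasure_cauchyTransform_eq_inner (jacobiOp S e s c b)
    (isSelfAdjoint_jacobiOp S e s c b) e he
  refine ⟨ν, fun z w hz hw h => ?_⟩
  have hn : 0 < Complex.normSq w := Complex.normSq_pos.2 (fun h => by simp [h] at hw)
  have him : (w + c / w).im = z.im := by rw [h]; simp
  -- `Im (w + c / w) = Im w * (1 - c / |w|²)` has to be positive.
  have hcw : c < ‖w‖ ^ 2 := by
    rw [← Complex.normSq_eq_norm_sq]
    simp [Complex.div_im] at him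
    by_contra! hle
    have : w.im ≤ c * w.im / Complex.normSq w := by
      rw [le_div_iff₀ hn]; nlinarith
    linarith
  have hzb : z - b ^ 2 / w ≠ 0 := fun h0 => by
    have h1 : (z - b ^ 2 / w).im = z.im + b ^ 2 * w.im / Complex.normSq w := by
      simp [Complex.div_im, ← Complex.ofReal_pow]
    rw [h0] at h1
    have : 0 ≤ b ^ 2 * w.im / Complex.normSq w := by positivity
    simp at h1
    linarith
  obtain ⟨x, hx, hx'⟩ := exists_jacobiOp_resolvent S e he hS hc hcw h hzb
  rw [recipCauchy, hν z x hz hx, hx', one_div_one_div]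

end JacobiOperator

/-! ### Free powers of a two-point law -/

section FreePowers

theorem im_ofReal_div_nonpos {c : ℝ} {a : ℂ} (hc : 0 ≤ c) (ha : 0 ≤ a.im) :
    ((c : ℂ) / a).im ≤ 0 := by
  have : ((c : ℂ) / a).im = -(c * a.im / Complex.normSq a) := by simp [Complex.div_im]
  rw [this, neg_nonpos]
  exact div_nonneg (mul_nonneg hc ha) (Complex.normSq_nonneg a)

/-- The solution `w = (z + i √(4c - z²)) / 2` of `w + c / w = z` that lies in the upper half plane
when `z` does and `0 ≤ c`. With this form of the square root the principal branch is analytic on the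
whole upper half plane. -/
noncomputable def joukowskiRoot (c : ℝ) (z : ℂ) : ℂ :=
  (z + Complex.I * (4 * c - z ^ 2 : ℂ) ^ (2⁻¹ : ℂ)) / 2

theorem four_mul_sub_sq_mem_slitPlane {c : ℝ} (hc : 0 ≤ c) {z : ℂ} (hz : 0 < z.im) :
    (4 * c - z ^ 2 : ℂ) ∈ Complex.slitPlane := by
  rw [Complex.mem_slitPlane_iff]
  by_cases h : z.re = 0
  · left
    simp [pow_two, h]
    positivity
  · right
    simp [pow_two]
    intro h'
    apply mul_ne_zero h hz.ne'
    linarith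

theorem joukowskiRoot_im_pos {c : ℝ} (hc : 0 ≤ c) {z : ℂ} (hz : 0 < z.im) :
    0 < (joukowskiRoot c z).im := by
  have hre : 0 < ((4 * c - z ^ 2 : ℂ) ^ (2⁻¹ : ℂ)).re := by
    rw [Complex.cpow_inv_two_re]
    have h := four_mul_sub_sq_mem_slitPlane hc hz
    apply Real.sqrt_pos.2
    have := Complex.abs_re_le_norm (4 * c - z ^ 2 : ℂ)
    have h3 := neg_abs_le (4 * c - z ^ 2 : ℂ).re
    rcases Complex.mem_slitPlane_iff.1 h with h1 | h1
    · have := norm_nonneg (4 * c - z ^ 2 : ℂ)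
      linarith
    · have := Complex.abs_re_lt_norm.2 h1
      linarith
  have : (joukowskiRoot c z).im = (z.im + ((4 * c - z ^ 2 : ℂ) ^ (2⁻¹ : ℂ)).re) / 2 := by
    rw [joukowskiRoot, Complex.div_ofNat_im]
    simp
  rw [this]
  positivity

theorem joukowskiRoot_add_div {c : ℝ} (hc : 0 ≤ c) {z : ℂ} (hz : 0 < z.im) :
    joukowskiRoot c z + c / joukowskiRoot c z = z := by
  have hne : joukowskiRoot c z ≠ 0 := fun h => by
    have := joukowskiRoot_im_pos hc hz
    simp [h] at this
  have hsq : ((4 * c - z ^ 2 : ℂ) ^ (2⁻¹ : ℂ)) ^ 2 = 4 * c - z ^ 2 :=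
    Complex.cpow_nat_inv_pow _ two_ne_zero
  field_simp
  rw [joukowskiRoot]
  linear_combination (-1/4 : ℂ) * hsq + ((4 * c - z ^ 2 : ℂ) ^ (2⁻¹ : ℂ)) ^ 2 / 4 * Complex.I_sq

/-- The two roots of `w + c / w = z` have product `c ≥ 0`, so at most one is in the upper half
plane. -/
theorem eq_of_add_div_eq {c : ℝ} (hc : 0 ≤ c) {a w : ℂ} (ha : 0 < a.im) (hw : 0 < w.im)
    (h : a + c / a = w + c / w) : a = w := by
  have ha0 : a ≠ 0 := fun h => by simp [h] at ha
  have hw0 : w ≠ 0 := fun h => by simp [h] at hw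
  have h1 : (a - w) * (a - c / w) = 0 := by
    have h2 : a * (c / a) = c := by field_simp
    have h3 : w * (c / w) = c := by field_simp
    linear_combination a * h - h2 + h3
  rcases mul_eq_zero.1 h1 with h2 | h2
  · exact sub_eq_zero.1 h2
  · have := im_ofReal_div_nonpos hc hw.le
    rw [← sub_eq_zero.1 h2] at this
    linarith

theorem le_im_of_add_div_eq {c : ℝ} (hc : 0 ≤ c) {a z : ℂ} (ha : 0 < a.im) (h : a + c / a = z) :
    z.im ≤ a.im := by
  have := im_ofReal_div_nonpos hc ha.le
  rw [← h, Complex.add_im]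
  linarith

theorem differentiableAt_joukowskiRoot {c : ℝ} (hc : 0 ≤ c) {z : ℂ} (hz : 0 < z.im) :
    DifferentiableAt ℂ (joukowskiRoot c) z := by
  unfold joukowskiRoot
  have := four_mul_sub_sq_mem_slitPlane hc hz
  have h1 : DifferentiableAt ℂ (fun z : ℂ => (4 * c - z ^ 2 : ℂ) ^ (2⁻¹ : ℂ)) z :=
    DifferentiableAt.cpow_const (by fun_prop) this
  fun_prop

/-- A bound `‖f z - z‖ ≤ D / Im z` gives `f z / z → 1` in every cone, since there `‖z‖` and `Im z`
are comparable. -/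
theorem classF_of_norm_sub_le {f : ℂ → ℂ} (D : ℝ) (hf : ∀ z, 0 < z.im → DifferentiableAt ℂ f z)
    (him : ∀ z, 0 < z.im → 0 ≤ (f z).im) (hD : ∀ z, 0 < z.im → ‖f z - z‖ ≤ D / z.im) :
    ClassF f where
  analytic := fun z hz => (hf z hz).differentiableWithinAt
  im_nonneg := him
  nontangential := fun α hα => by
    rw [tendsto_iff_norm_sub_tendsto_zero]
    have hlim : Tendsto (fun z : ℂ => D * (α + 1) / ‖z‖ ^ 2)
        (Bornology.cobounded ℂ ⊓ 𝓟 (cone α)) (𝓝 0) := by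
      apply Tendsto.mono_left _ inf_le_left
      exact ((tendsto_pow_atTop two_ne_zero).comp tendsto_norm_cobounded_atTop).const_div_atTop _
    refine squeeze_zero' (Eventually.of_forall fun z => norm_nonneg _) ?_ hlim
    filter_upwards [mem_inf_of_right (mem_principal_self _)] with z hz
    obtain ⟨hz1, hz2⟩ := hz
    have hz0 : z ≠ 0 := fun h => by simp [h] at hz1
    have hzn : 0 < ‖z‖ := norm_pos_iff.2 hz0
    have hD0 : 0 ≤ D := by
      have := (norm_nonneg _).trans (hD z hz1)
      by_contra! h
      exact absurd this (not_le.2 (div_neg_of_neg_of_pos h hz1))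
    have hn : ‖z‖ ≤ (α + 1) * z.im := by
      have := Complex.norm_le_abs_re_add_abs_im z
      rw [abs_of_pos hz1] at this
      linarith
    rw [div_sub_one hz0, norm_div, div_le_div_iff₀ hzn (by positivity)]
    have h1 := (le_div_iff₀ hz1).1 (hD z hz1)
    calc ‖f z - z‖ * ‖z‖ ^ 2 = ‖f z - z‖ * ‖z‖ * ‖z‖ := by ring
      _ ≤ ‖f z - z‖ * ((α + 1) * z.im) * ‖z‖ := by gcongr
      _ = (‖f z - z‖ * z.im) * ((α + 1) * ‖z‖) := by ring
      _ ≤ D * ((α + 1) * ‖z‖) := by gcongr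
      _ = _ := by ring

/-- `ν` is the `κ`-th free convolution power of the two-point law with reciprocal Cauchy transform
`z - v / (z - s)`, described by its own reciprocal Cauchy transform: this is `z - κ v / w`, with `w`
the root of `w + (κ - 1) v / w = z - s` in the upper half plane (the hypotheses determine `w`). -/
def IsFreeBinomial (s v κ : ℝ) (ν : ProbabilityMeasure ℝ) : Prop :=
  ∀ z w : ℂ, 0 < z.im → 0 < w.im → w + (((κ - 1) * v : ℝ) : ℂ) / w = z - s →
    recipCauchy ν z = z - ((κ * v : ℝ) : ℂ) / w

/-- Real arguments are outside the domain of the reciprocal Cauchy transform, but subordination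
functions are only required to have nonnegative imaginary part; this rules out real values. -/
theorem recipCauchy_im_eq_zero (μ : ProbabilityMeasure ℝ) {z : ℂ} (hz : z.im = 0) :
    (recipCauchy μ z).im = 0 := by
  obtain ⟨x, rfl⟩ : ∃ x : ℝ, z = x := ⟨z.re, Complex.ext (by simp) (by simp [hz])⟩
  have : cauchyTransform μ x = ((∫ t : ℝ, 1 / (x - t) ∂(μ : Measure ℝ) : ℝ) : ℂ) := by
    rw [cauchyTransform, ← integral_complex_ofReal]
    push_cast
    rfl
  rw [recipCauchy, this, ← Complex.ofReal_one, ← Complex.ofReal_div, Complex.ofReal_im]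

variable {s v κ : ℝ} {ν μ : ProbabilityMeasure ℝ}

theorem IsFreeBinomial.exists_root (h : IsFreeBinomial s v κ ν) (hv : 0 < v) (hκ : 1 ≤ κ) {z : ℂ}
    (hz : 0 < z.im) : ∃ w : ℂ, 0 < w.im ∧ w + (((κ - 1) * v : ℝ) : ℂ) / w = z - s ∧
      recipCauchy ν z = z - ((κ * v : ℝ) : ℂ) / w := by
  have hc : 0 ≤ (κ - 1) * v := mul_nonneg (by linarith) hv.le
  have hz' : 0 < (z - s).im := by simpa using hz
  exact ⟨_, joukowskiRoot_im_pos hc hz', joukowskiRoot_add_div hc hz',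
    h _ _ hz (joukowskiRoot_im_pos hc hz') (joukowskiRoot_add_div hc hz')⟩

theorem IsFreeBinomial.recipCauchy_of_one (h : IsFreeBinomial s v 1 μ) {z : ℂ} (hz : 0 < z.im) :
    recipCauchy μ z = z - v / (z - s) := by
  rw [h z (z - s) hz (by simpa using hz) (by simp), one_mul]

/-- Every free convolution of the `κ`-th power with the two-point law is the `κ + 1`-st power. At
each point the subordination equations reduce to a quadratic equation for `Z₂ z - s`, and one of its
roots contradicts `0 < Im z`; the normalization of `Z₁`, `Z₂` at infinity is not needed. -/
theorem IsFreeBinomial.of_isFreeConv (hν : IsFreeBinomial s v κ ν) (hμ : IsFreeBinomial s v 1 μ)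
    (hv : 0 < v) (hκ : 1 ≤ κ) {ρ : ProbabilityMeasure ℝ} (h : IsFreeConv ν μ ρ) :
    IsFreeBinomial s v (κ + 1) ρ := by
  obtain ⟨Z₁, Z₂, hZ₁, hZ₂, hZ⟩ := h
  intro z w' hz hw' hzw
  obtain ⟨hA, hB, hC⟩ := hZ z hz
  -- If `Z₂ z` were real, so would be `F_ν (Z₁ z)`, although `Z₁ z` is in the upper half plane.
  have him₂ : 0 < (Z₂ z).im := by
    refine lt_of_le_of_ne (hZ₂.im_nonneg z hz) fun h0 => ?_
    have hF := recipCauchy_im_eq_zero μ h0.symm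
    rw [← hB] at hF
    have hi : z.im = (Z₁ z).im := by
      have := congrArg Complex.im hA
      simp only [Complex.sub_im, Complex.add_im, hF, ← h0] at this
      linarith
    obtain ⟨w, hw, -, hwF⟩ := hν.exists_root hv hκ (hi ▸ hz)
    have := im_ofReal_div_nonpos (c := κ * v) (by positivity) hw.le
    rw [hwF, Complex.sub_im] at hF
    linarith
  rw [hμ.recipCauchy_of_one him₂] at hB
  set a := Z₂ z - s with ha
  have ha' : 0 < a.im := by simpa [ha] using him₂
  have hZ₁a : Z₁ z = z - v / a := by linear_combination hB - hA
  have him₁ : 0 < (Z₁ z).im := by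
    have := im_ofReal_div_nonpos hv.le ha'.le
    rw [hZ₁a, Complex.sub_im]
    linarith
  obtain ⟨w, hw, hwz, hwF⟩ := hν.exists_root hv hκ him₁
  have ha0 : a ≠ 0 := fun h => by simp [h] at ha'
  have hw0 : w ≠ 0 := fun h => by simp [h] at hw
  push_cast at hwz hwF hzw ⊢
  have hva : v / a * a = v := by field_simp
  have hvw : v / w * w = v := by field_simp
  rw [mul_div_assoc] at hwz hwF
  have hkey : (w - a) * (w * a + v) = 0 := by
    linear_combination w * a * (hwz - hwF + hB - ha) + a * hvw - w * hva
  rcases mul_eq_zero.1 hkey with h1 | h1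
  · have hwa : w = a := sub_eq_zero.1 h1
    have hkv : 0 ≤ κ * v := by positivity
    have haw' : a = w' := by
      refine eq_of_add_div_eq hkv ha' hw' ?_
      push_cast
      rw [hwa] at hwz
      rw [add_sub_cancel_right] at hzw
      rw [hzw, mul_div_assoc]
      linear_combination hwz + hZ₁a
    rw [hC, hB, ← haw']
    rw [← haw', add_sub_cancel_right, mul_div_assoc] at hzw
    rw [mul_div_assoc]
    linear_combination hzw - ha
  -- The root `w a = -v` forces `z = s - (κ - 1) a`, which is not in the upper half plane.
  · exfalso
    have h2 : (v : ℂ) / a = -w := by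
      rw [div_eq_iff ha0]
      linear_combination h1
    have h3 : (v : ℂ) / w = -a := by
      rw [div_eq_iff hw0]
      linear_combination h1
    have h4 : z = s - ((κ - 1 : ℝ) : ℂ) * a := by
      push_cast
      rw [h3] at hwz
      rw [h2] at hZ₁a
      linear_combination -hwz - hZ₁a
    have h5 : z.im = -((κ - 1) * a.im) := by
      rw [h4, Complex.sub_im, Complex.im_ofReal_mul]
      simp
    have : 0 ≤ (κ - 1) * a.im := mul_nonneg (by linarith) ha'.le
    linarith

/-- With `a` the root of `a + κ v / a = z - s`, the subordination functions are `z - v / a` and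
`s + a`. -/
theorem IsFreeBinomial.exists_isFreeConv (hν : IsFreeBinomial s v κ ν) (hμ : IsFreeBinomial s v 1 μ)
    (hv : 0 < v) (hκ : 1 ≤ κ) : ∃ ρ, IsFreeConv ν μ ρ := by
  have hc : 0 < κ * v := by positivity
  obtain ⟨ρ, hρ⟩ := exists_recipCauchy_eq (s := s) (b := Real.sqrt ((κ + 1) * v)) hc
  have hsq : ((Real.sqrt ((κ + 1) * v) : ℝ) : ℂ) ^ 2 = (κ + 1) * v := by
    exact_mod_cast Real.sq_sqrt (by positivity)
  let a : ℂ → ℂ := fun z => joukowskiRoot (κ * v) (z - s)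
  have hs : ∀ z : ℂ, 0 < z.im → 0 < (z - s).im := fun z hz => by simpa using hz
  have ha : ∀ z : ℂ, 0 < z.im → 0 < (a z).im := fun z hz =>
    joukowskiRoot_im_pos hc.le (hs z hz)
  have ha0 : ∀ z : ℂ, 0 < z.im → a z ≠ 0 := fun z hz h => by
    have := ha z hz
    simp [h] at this
  have hadd : ∀ z : ℂ, 0 < z.im → a z + ((κ * v : ℝ) : ℂ) / a z = z - s := fun z hz =>
    joukowskiRoot_add_div hc.le (hs z hz)
  have hle : ∀ z : ℂ, 0 < z.im → z.im ≤ ‖a z‖ := fun z hz => by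
    have h1 := le_im_of_add_div_eq hc.le (ha z hz) (hadd z hz)
    have h2 := Complex.im_le_norm (a z)
    simp at h1
    linarith
  have hdiff : ∀ z : ℂ, 0 < z.im → DifferentiableAt ℂ a z := fun z hz =>
    (differentiableAt_joukowskiRoot hc.le (hs z hz)).comp z
      (differentiableAt_id.sub_const _)
  have hnorm : ∀ c : ℝ, 0 ≤ c → ∀ z : ℂ, 0 < z.im → ‖(c : ℂ) / a z‖ ≤ c / z.im :=
      fun c h0 z hz => by
    rw [norm_div, Complex.norm_real, Real.norm_of_nonneg h0]
    exact div_le_div_of_nonneg_left h0 hz (hle z hz)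
  have him₁ : ∀ z : ℂ, 0 < z.im → 0 < (z - v / a z).im := fun z hz => by
    have := im_ofReal_div_nonpos hv.le (ha z hz).le
    rw [Complex.sub_im]
    linarith
  have him₂ : ∀ z : ℂ, 0 < z.im → 0 < (s + a z).im := fun z hz => by simpa using ha z hz
  refine ⟨ρ, fun z => z - v / a z, fun z => s + a z, ?_, ?_, fun z hz => ?_⟩
  · refine classF_of_norm_sub_le v (fun z hz => ?_) (fun z hz => (him₁ z hz).le) fun z hz => ?_
    · exact differentiableAt_id.sub ((differentiableAt_const _).div (hdiff z hz) (ha0 z hz))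
    · rw [sub_sub_cancel_left, norm_neg]
      exact hnorm v hv.le z hz
  · refine classF_of_norm_sub_le (κ * v) (fun z hz => (hdiff z hz).const_add _)
      (fun z hz => (him₂ z hz).le) fun z hz => ?_
    have : s + a z - z = -(((κ * v : ℝ) : ℂ) / a z) := by linear_combination hadd z hz
    rw [this, norm_neg]
    exact hnorm _ hc.le z hz
  · have hz' : 0 < z.im := hz
    have h1 := hadd z hz
    have hF₁ := hν (z - v / a z) (a z) (him₁ z hz) (ha z hz) (by
      push_cast at h1 ⊢
      linear_combination h1)
    have hF₂ := hμ.recipCauchy_of_one (him₂ z hz)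
    have hF := hρ z (a z) hz (ha z hz) h1
    rw [add_sub_cancel_left] at hF₂
    push_cast at h1 hF₁
    rw [hsq] at hF
    simp only [hF₁, hF₂, hF]
    refine ⟨?_, ?_, ?_⟩
    · linear_combination -h1
    · linear_combination -h1
    · ring

/-- Since the free convolution exists at each step, the choice made in `freeConv` satisfies its
defining equations, and these determine the reciprocal Cauchy transform. -/
theorem isFreeBinomial_freePow (hμ : IsFreeBinomial s v 1 μ) (hv : 0 < v) (k : ℕ) :
    IsFreeBinomial s v (k + 1) (freePow μ (k + 1)) := by
  induction k with
  | zero => simpa [freePow] using hμ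
  | succ k ih =>
    have hk : (1 : ℝ) ≤ k + 1 := by simp
    have h : IsFreeConv (freePow μ (k + 1)) μ (freePow μ (k + 2)) :=
      Classical.epsilon_spec (ih.exists_isFreeConv hμ hv hk)
    push_cast
    exact ih.of_isFreeConv hμ hv hk h

end FreePowers

/-! ### Lower bounds for the Lévy distance -/

section LowerBound

theorem integral_eq_of_two_atoms (μ : ProbabilityMeasure ℝ) {p q a b : ℝ} (hp : 0 ≤ p) (hq : 0 ≤ q)
    (hpq : q + p = 1) (hab : a ≠ b) (ha : (μ : Measure ℝ) {a} = ENNReal.ofReal q)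
    (hb : (μ : Measure ℝ) {b} = ENNReal.ofReal p) {E : Type*} [NormedAddCommGroup E]
    [NormedSpace ℝ E] [CompleteSpace E] (f : ℝ → E) :
    ∫ t, f t ∂(μ : Measure ℝ) = q • f a + p • f b := by
  have hd : Disjoint ({a} : Set ℝ) {b} := by simpa using hab
  have hu : (μ : Measure ℝ) ({a} ∪ {b}) = 1 := by
    rw [measure_union hd (measurableSet_singleton b), ha, hb, ← ENNReal.ofReal_add hq hp, hpq,
      ENNReal.ofReal_one]
  have hr : (μ : Measure ℝ).restrict ({a} ∪ {b}) = μ :=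
    Measure.restrict_eq_self_of_ae_mem (by
      rw [← prob_compl_eq_zero_iff ((measurableSet_singleton a).union (measurableSet_singleton b))]
        at hu
      exact hu)
  rw [← hr, setIntegral_union hd (measurableSet_singleton b)
    (integrableOn_singleton (by simp)) (integrableOn_singleton (by simp)), integral_singleton,
    integral_singleton, measureReal_def, measureReal_def, ha, hb, ENNReal.toReal_ofReal hp, ENNReal.toReal_ofReal hq]

/-- The rescaled standardized two-point law has atoms `A`, `B` with mean `0`, `A B = -1 / n` and
`A + B = (√(q/p) - √(p/q)) / √n`, so its reciprocal Cauchy transform is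
`z - (1 / n) / (z - (A + B))`. -/
theorem isFreeBinomial_rescale {p q : ℝ} (hp : 0 < p) (hq : 0 < q) (hpq : q + p = 1)
    (μ : ProbabilityMeasure ℝ) (ha : (μ : Measure ℝ) {-Real.sqrt (p / q)} = ENNReal.ofReal q)
    (hb : (μ : Measure ℝ) {Real.sqrt (q / p)} = ENNReal.ofReal p) {n : ℕ} (hn : 1 ≤ n) :
    IsFreeBinomial ((Real.sqrt (q / p) - Real.sqrt (p / q)) / Real.sqrt n) (1 / n) 1
      (rescale μ n) := by
  have ha0 : 0 < Real.sqrt (p / q) := by positivity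
  have hb0 : 0 < Real.sqrt (q / p) := by positivity
  have ha2 : Real.sqrt (p / q) ^ 2 = p / q := Real.sq_sqrt (by positivity)
  have hb2 : Real.sqrt (q / p) ^ 2 = q / p := Real.sq_sqrt (by positivity)
  have hab : Real.sqrt (p / q) * Real.sqrt (q / p) = 1 := by
    rw [← Real.sqrt_mul (by positivity)]
    simp [hp.ne', hq.ne']
  set a := Real.sqrt (p / q)
  set b := Real.sqrt (q / p)
  have hmean : q * a = p * b := by
    have h1 : q * a ^ 2 = p := by rw [ha2]; field_simp
    calc q * a = q * a * (a * b) := by rw [hab, mul_one]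
      _ = (q * a ^ 2) * b := by ring
      _ = p * b := by rw [h1]
  have hI := fun {E : Type} [NormedAddCommGroup E] [NormedSpace ℝ E] [CompleteSpace E]
      (f : ℝ → E) =>
    integral_eq_of_two_atoms μ hp.le hq.le hpq (by linarith) ha hb f
  have hm : secondMoment μ = 1 := by
    rw [secondMoment, hI]
    simp only [smul_eq_mul, neg_sq, ha2, hb2]
    field_simp
    linarith
  have hn0 : (0 : ℝ) < n := by exact_mod_cast hn
  have hr : 0 < Real.sqrt n := Real.sqrt_pos.2 hn0
  intro z w hz hw hzw
  have hG : cauchyTransform (rescale μ n) z =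
      q * (1 / (z - ((-a / Real.sqrt n : ℝ) : ℂ))) +
        p * (1 / (z - ((b / Real.sqrt n : ℝ) : ℂ))) := by
    have h1 : cauchyTransform (rescale μ n) z =
        ∫ t : ℝ, 1 / (z - ((t / Real.sqrt (secondMoment μ * n) : ℝ) : ℂ)) ∂(μ : Measure ℝ) :=
      integral_map (by fun_prop) (by apply Measurable.aestronglyMeasurable; fun_prop)
    rw [h1, hm, one_mul, hI, Complex.real_smul, Complex.real_smul]
  have hne : ∀ x : ℝ, z - x ≠ 0 := fun x h => by
    have := congrArg Complex.im h
    simp at this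
    exact hz.ne' this
  have hA := hne (-a / Real.sqrt n)
  have hB := hne (b / Real.sqrt n)
  have hS := hne ((b - a) / Real.sqrt n)
  have hwS : w = z - (((b - a) / Real.sqrt n : ℝ) : ℂ) := by simpa using hzw
  rw [recipCauchy, hG, hwS]
  set A : ℝ := -a / Real.sqrt n with hAdef
  set B : ℝ := b / Real.sqrt n with hBdef
  have hSAB : (b - a) / Real.sqrt n = A + B := by rw [hAdef, hBdef]; ring
  have hAB : A * B = -(1 * (1 / n)) := by
    rw [hAdef, hBdef, div_mul_div_comm, neg_mul, hab, Real.mul_self_sqrt hn0.le]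
    ring
  have hmean' : q * B + p * A = A + B := by
    have : q * A + p * B = 0 := by rw [hAdef, hBdef]; field_simp; linarith
    linear_combination (A + B) * hpq - this
  rw [hSAB] at hS ⊢
  have hABc : (A : ℂ) * B = -((1 * (1 / n) : ℝ) : ℂ) := by rw [← Complex.ofReal_mul, hAB]; simp
  have hmc : (q : ℂ) * B + p * A = A + B := by exact_mod_cast hmean'
  have hpqc : (q : ℂ) + p = 1 := by exact_mod_cast hpq
  have hnum : (q : ℂ) * (1 / (z - A)) + p * (1 / (z - B)) =
      (z - (A + B : ℝ)) / ((z - A) * (z - B)) := by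
    push_cast
    field_simp
    linear_combination z * hpqc - hmc
  have hcancel := div_mul_cancel₀ ((1 * (1 / n) : ℝ) : ℂ) hS
  rw [hnum, one_div_div, div_eq_iff hS]
  push_cast at hABc hcancel ⊢
  linear_combination hABc + hcancel

/-- The asymmetry of the `n`-fold free power is visible at the single point `i`. With `σ = s / √n`
and `c = 1 - 1 / n`, the real part of `w + c / w = i - σ` reads `Re w * (1 + c / |w|²) = -σ`, so
`|Re w| ≥ |σ| / 2`; then `G = 1 / (i - 1 / w)` inherits a real part of this order. -/
theorem abs_re_cauchyTransform_I_ge {s : ℝ} {n : ℕ} (hn : 1 ≤ n) {ν : ProbabilityMeasure ℝ}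
    (hν : IsFreeBinomial (s / Real.sqrt n) (1 / n) n ν) :
    |s| / (8 * (2 + |s|) ^ 2) / Real.sqrt n ≤ |(cauchyTransform ν Complex.I).re| := by
  have hn1 : (1 : ℝ) ≤ n := by exact_mod_cast hn
  have hn0 : (0 : ℝ) < n := by linarith
  have hr : 1 ≤ Real.sqrt n := Real.one_le_sqrt.2 hn1
  set σ := s / Real.sqrt n with hσ
  have hσs : |σ| ≤ |s| := by
    rw [hσ, abs_div, abs_of_nonneg (Real.sqrt_nonneg _)]
    exact div_le_self (abs_nonneg _) hr
  obtain ⟨w, hw, hwz, hwF⟩ := hν.exists_root (by positivity) hn1 (z := Complex.I) (by simp)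
  have hc1 : ((n : ℝ) * (1 / n) : ℝ) = 1 := by field_simp
  rw [hc1] at hwF
  set c : ℝ := ((n : ℝ) - 1) * (1 / n) with hc
  have hc0 : 0 ≤ c := mul_nonneg (by linarith) (by positivity)
  have hcle : c ≤ 1 := by
    rw [hc, sub_mul, hc1]
    have : 0 ≤ 1 * (1 / (n : ℝ)) := by positivity
    linarith
  have hwim : 1 ≤ w.im := by
    have := le_im_of_add_div_eq hc0 hw hwz
    simpa using this
  have hwn : 1 ≤ ‖w‖ := hwim.trans (Complex.im_le_norm w)
  have hwn0 : 0 < ‖w‖ := by linarith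
  have hw2 : 1 ≤ ‖w‖ ^ 2 := one_le_pow₀ hwn
  have hre : |σ| ≤ 2 * |w.re| := by
    have h1 := congrArg Complex.re hwz
    have h2 : w.re * (1 + c / ‖w‖ ^ 2) = -σ := by
      simp [Complex.div_re, Complex.normSq_eq_norm_sq] at h1
      rw [← h1]
      ring
    rw [← abs_neg, ← h2, abs_mul, mul_comm 2]
    gcongr
    rw [abs_of_nonneg (by positivity)]
    have : c / ‖w‖ ^ 2 ≤ 1 := (div_le_one (by positivity)).2 (hcle.trans hw2)
    linarith
  have hwle : ‖w‖ ≤ 2 + |s| := by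
    have h1 : w = Complex.I - σ - c / w := by rw [← hwz]; ring
    calc ‖w‖ = ‖Complex.I - σ - c / w‖ := by rw [← h1]
      _ ≤ ‖(Complex.I : ℂ)‖ + ‖(σ : ℂ)‖ + ‖(c : ℂ) / w‖ :=
        (norm_sub_le _ _).trans (by gcongr; exact norm_sub_le _ _)
      _ ≤ 1 + |s| + 1 := by
        rw [Complex.norm_I, norm_div, Complex.norm_real, Complex.norm_real, Real.norm_eq_abs,
          Real.norm_of_nonneg hc0]
        gcongr
        exact (div_le_one hwn0).2 (hcle.trans hwn)
      _ = 2 + |s| := by ring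
  set F := recipCauchy ν Complex.I with hF
  have hFre : F.re = -(w.re / ‖w‖ ^ 2) := by
    rw [hwF]
    simp [Complex.normSq_eq_norm_sq]
  have hFim : 1 ≤ F.im := by
    have := im_ofReal_div_nonpos (c := 1) zero_le_one hw.le
    rw [hwF, Complex.sub_im, Complex.I_im]
    linarith
  have hFn : 1 ≤ ‖F‖ := hFim.trans (Complex.im_le_norm F)
  have hFle : ‖F‖ ≤ 2 := by
    rw [hwF]
    refine (norm_sub_le _ _).trans ?_
    rw [Complex.norm_I, norm_div]
    simp only [Complex.ofReal_one, norm_one]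
    have : 1 / ‖w‖ ≤ 1 := (div_le_one hwn0).2 hwn
    linarith
  have hG : cauchyTransform ν Complex.I = 1 / F := by rw [hF, recipCauchy, one_div_one_div]
  have hGre : |(cauchyTransform ν Complex.I).re| = |w.re| / (‖w‖ ^ 2 * ‖F‖ ^ 2) := by
    have : (1 / F).re = F.re / ‖F‖ ^ 2 := by simp [Complex.normSq_eq_norm_sq]
    rw [hG, this, hFre, abs_div, abs_neg, abs_div, abs_of_nonneg (sq_nonneg ‖w‖),
      abs_of_nonneg (sq_nonneg ‖F‖), div_div]
  have hσ' : |σ| = |s| / Real.sqrt n := by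
    rw [hσ, abs_div, abs_of_nonneg (Real.sqrt_nonneg _)]
  calc |s| / (8 * (2 + |s|) ^ 2) / Real.sqrt n = (|σ| / 2) / ((2 + |s|) ^ 2 * 2 ^ 2) := by
        rw [hσ']; field_simp; ring
    _ ≤ |w.re| / (‖w‖ ^ 2 * ‖F‖ ^ 2) := by
        gcongr
        linarith
    _ = _ := hGre.symm

theorem re_one_div_I_sub (t : ℝ) : (1 / (Complex.I - t)).re = -(t / (1 + t ^ 2)) := by
  rw [one_div, Complex.inv_re]
  simp [Complex.normSq_apply]
  ring

theorem re_cauchyTransform_I (ν : ProbabilityMeasure ℝ) :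
    (cauchyTransform ν Complex.I).re = -∫ t, t / (1 + t ^ 2) ∂(ν : Measure ℝ) := by
  have hint : Integrable (fun t : ℝ => 1 / (Complex.I - t)) (ν : Measure ℝ) := by
    refine Integrable.of_bound (C := 1) (by apply Measurable.aestronglyMeasurable; fun_prop)
      (Eventually.of_forall fun t => ?_)
    have h := Complex.abs_im_le_norm (Complex.I - t)
    simp at h
    rw [norm_div, norm_one]
    exact (div_le_one (by linarith)).2 h
  have := integral_re hint
  simp only [RCLike.re_to_complex] at this
  rw [cauchyTransform, ← this, ← integral_neg]
  simp only [re_one_div_I_sub]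

theorem hasDerivAt_div_one_add_sq (x : ℝ) :
    HasDerivAt (fun t : ℝ => t / (1 + t ^ 2)) ((1 - x ^ 2) / (1 + x ^ 2) ^ 2) x := by
  have h : HasDerivAt (fun t : ℝ => 1 + t ^ 2) (2 * x) x := by
    simpa using (hasDerivAt_pow 2 x).const_add 1
  convert! (hasDerivAt_id x).div h (by positivity) using 2
  simp
  ring

theorem abs_deriv_div_one_add_sq_le (x : ℝ) :
    |(1 - x ^ 2) / (1 + x ^ 2) ^ 2| ≤ (1 + x ^ 2)⁻¹ := by
  rw [abs_div, abs_of_pos (by positivity : 0 < (1 + x ^ 2) ^ 2), inv_eq_one_div,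
    div_le_div_iff₀ (by positivity) (by positivity)]
  have : |1 - x ^ 2| ≤ 1 + x ^ 2 := abs_le.2 ⟨by linarith, by nlinarith [sq_nonneg x]⟩
  nlinarith [sq_nonneg x]

theorem integrable_deriv_div_one_add_sq :
    Integrable fun x : ℝ => (1 - x ^ 2) / (1 + x ^ 2) ^ 2 :=
  integrable_inv_one_add_sq.mono' (by apply Measurable.aestronglyMeasurable; fun_prop)
    (Eventually.of_forall abs_deriv_div_one_add_sq_le)

/-- Integration by parts of `t / (1 + t²)` against a finite measure; there is no boundary term, as
the function vanishes at infinity. -/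
theorem integral_div_one_add_sq_eq (ν : Measure ℝ) [IsFiniteMeasure ν] :
    ∫ t, t / (1 + t ^ 2) ∂ν = -∫ x, (1 - x ^ 2) / (1 + x ^ 2) ^ 2 * ν.real (Set.Iio x) := by
  set g : ℝ → ℝ := fun x => (1 - x ^ 2) / (1 + x ^ 2) ^ 2 with hg
  have hlim : Tendsto (fun t : ℝ => t / (1 + t ^ 2)) atTop (𝓝 0) := by
    refine squeeze_zero_norm' ?_ tendsto_inv_atTop_zero
    filter_upwards [eventually_gt_atTop 0] with t ht
    rw [Real.norm_of_nonneg (by positivity), inv_eq_one_div, div_le_div_iff₀ (by positivity) ht]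
    nlinarith
  have h1 : ∀ t : ℝ, t / (1 + t ^ 2) = -∫ x, (Set.Ioi t).indicator g x := fun t => by
    rw [integral_indicator measurableSet_Ioi, integral_Ioi_of_hasDerivAt_of_tendsto'
      (fun x _ => hasDerivAt_div_one_add_sq x) integrable_deriv_div_one_add_sq.integrableOn hlim]
    ring
  have hprod : Integrable (Function.uncurry fun t x : ℝ => (Set.Ioi t).indicator g x)
      (ν.prod volume) := by
    have h2 : Integrable (fun y : ℝ × ℝ => g y.2) (ν.prod volume) :=
      integrable_deriv_div_one_add_sq.comp_snd ν
    have h3 := h2.indicator (measurableSet_lt measurable_fst measurable_snd)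
    convert! h3 using 1
  simp_rw [h1]
  rw [integral_neg, integral_integral_swap hprod]
  congr 1
  refine integral_congr_ae (Eventually.of_forall fun x => ?_)
  have : (fun t : ℝ => (Set.Ioi t).indicator g x) = (Set.Iio x).indicator fun _ => g x := by
    ext t
    simp [Set.indicator_apply]
  simp only [this]
  rw [integral_indicator measurableSet_Iio, setIntegral_const, smul_eq_mul, mul_comm]

theorem abs_integral_sub_integral_le (μ ν : Measure ℝ) [IsFiniteMeasure μ] [IsFiniteMeasure ν]
    {D : ℝ} (hD : ∀ x, |μ.real (Set.Iio x) - ν.real (Set.Iio x)| ≤ D) :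
    |∫ t, t / (1 + t ^ 2) ∂μ - ∫ t, t / (1 + t ^ 2) ∂ν| ≤ D * Real.pi := by
  have hint : ∀ (ρ : Measure ℝ) [IsFiniteMeasure ρ],
      Integrable fun x : ℝ => (1 - x ^ 2) / (1 + x ^ 2) ^ 2 * ρ.real (Set.Iio x) := fun ρ _ => by
    have hmono : Monotone fun x : ℝ => ρ.real (Set.Iio x) := fun x y hxy =>
      measureReal_mono (Set.Iio_subset_Iio hxy)
    refine integrable_deriv_div_one_add_sq.mul_bdd (c := ρ.real Set.univ)
      hmono.measurable.aestronglyMeasurable (Eventually.of_forall fun x => ?_)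
    rw [Real.norm_of_nonneg measureReal_nonneg]
    exact measureReal_mono (Set.subset_univ _)
  rw [integral_div_one_add_sq_eq μ, integral_div_one_add_sq_eq ν, neg_sub_neg,
    ← integral_sub (hint ν) (hint μ), ← integral_univ_inv_one_add_sq, ← integral_const_mul,
    ← Real.norm_eq_abs]
  refine norm_integral_le_of_norm_le (integrable_inv_one_add_sq.const_mul D)
    (Eventually.of_forall fun x => ?_)
  rw [← mul_sub, norm_mul, mul_comm D, Real.norm_eq_abs, Real.norm_eq_abs, abs_sub_comm (ν.real _)]
  exact mul_le_mul (abs_deriv_div_one_add_sq_le x) (hD x) (abs_nonneg _) (by positivity)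

theorem semicircle_density_le (x : ℝ) :
    ENNReal.ofReal (1 / (2 * Real.pi) * Real.sqrt (max (4 - x ^ 2) 0)) ≤
      (Set.Icc (-2 : ℝ) 2).indicator 1 x := by
  by_cases hx : x ∈ Set.Icc (-2 : ℝ) 2
  · rw [Set.indicator_of_mem hx]
    simp only [Pi.one_apply, ENNReal.ofReal_le_one]
    have h1 : Real.sqrt (max (4 - x ^ 2) 0) ≤ 2 := by
      rw [Real.sqrt_le_left (by norm_num)]
      exact max_le (by nlinarith [sq_nonneg x]) (by norm_num)
    have h2 := Real.pi_gt_three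
    rw [one_div_mul_eq_div, div_le_one (by positivity)]
    linarith
  · rw [Set.indicator_of_notMem hx]
    have : max (4 - x ^ 2) 0 = 0 := max_eq_right (by
      by_contra! h
      exact hx (abs_le.1 (abs_le_of_sq_le_sq (by linarith) (by norm_num))))
    simp [this]

theorem semicircle_apply_le {A : Set ℝ} (hA : MeasurableSet A) : semicircle A ≤ volume A := by
  rw [semicircle, withDensity_apply _ hA, ← setLIntegral_one]
  refine lintegral_mono fun x => (semicircle_density_le x).trans ?_
  exact Set.indicator_le_self' (by simp) x

instance : IsFiniteMeasure semicircle := ⟨by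
  rw [semicircle, withDensity_apply _ MeasurableSet.univ, Measure.restrict_univ]
  calc _ ≤ ∫⁻ x, (Set.Icc (-2 : ℝ) 2).indicator 1 x := lintegral_mono semicircle_density_le
    _ < ⊤ := by
      rw [lintegral_indicator_one measurableSet_Icc]
      simp⟩

theorem semicircle_real_Iio_sub_le {x y : ℝ} (hxy : x ≤ y) :
    semicircle.real (Set.Iio y) ≤ semicircle.real (Set.Iio x) + (y - x) := by
  rw [← Set.Iio_union_Ico_eq_Iio hxy]
  refine (measureReal_union_le _ _).trans ?_
  gcongr
  rw [measureReal_def]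
  refine ENNReal.toReal_le_of_le_ofReal (by linarith) ?_
  exact (semicircle_apply_le measurableSet_Ico).trans (by rw [Real.volume_Ico])

/-- The semicircle law is symmetric. -/
theorem integral_semicircle_div_one_add_sq : ∫ t, t / (1 + t ^ 2) ∂semicircle = 0 := by
  have h : Measurable fun x : ℝ =>
      ENNReal.ofReal (1 / (2 * Real.pi) * Real.sqrt (max (4 - x ^ 2) 0)) := by
    fun_prop
  rw [semicircle, integral_withDensity_eq_integral_toReal_smul h (by simp)]
  have hodd := integral_neg_eq_self (fun x : ℝ =>
    (ENNReal.ofReal (1 / (2 * Real.pi) * Real.sqrt (max (4 - x ^ 2) 0))).toReal • (x / (1 + x ^ 2)))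
    volume
  simp only [neg_sq, neg_div, smul_neg, integral_neg] at hodd
  linarith

section Levy

variable {μ ν : Measure ℝ} [IsFiniteMeasure μ] {h : ℝ}

theorem real_Iio_mono (μ : Measure ℝ) [IsFiniteMeasure μ] :
    Monotone fun x : ℝ => μ.real (Set.Iio x) :=
  fun _ _ hxy => measureReal_mono (Set.Iio_subset_Iio hxy)

/-- For `h < 0` the two inequalities contradict the monotonicity of `x ↦ μ (-∞, x)`; so the infimum
defining `levyDist` is over a set bounded below. -/
theorem nonneg_of_levy_bounds (hh : ∀ x : ℝ, μ.real (Set.Iio (x - h)) - h ≤ ν.real (Set.Iio x) ∧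
    ν.real (Set.Iio x) ≤ μ.real (Set.Iio (x + h)) + h) : 0 ≤ h := by
  by_contra! hneg
  obtain ⟨h1, h2⟩ := hh 0
  have : μ.real (Set.Iio (0 + h)) ≤ μ.real (Set.Iio (0 - h)) := real_Iio_mono μ (by linarith)
  linarith

theorem levy_bounds_kolmogorovDist [IsFiniteMeasure ν] (x : ℝ) :
    μ.real (Set.Iio (x - kolmogorovDist μ ν)) - kolmogorovDist μ ν ≤ ν.real (Set.Iio x) ∧
    ν.real (Set.Iio x) ≤ μ.real (Set.Iio (x + kolmogorovDist μ ν)) + kolmogorovDist μ ν := by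
  have hbdd : BddAbove (Set.range fun x : ℝ => |μ.real (Set.Iio x) - ν.real (Set.Iio x)|) := by
    refine ⟨μ.real Set.univ + ν.real Set.univ, ?_⟩
    rintro _ ⟨x, rfl⟩
    have h1 : μ.real (Set.Iio x) ≤ μ.real Set.univ := measureReal_mono (Set.subset_univ _)
    have h2 : ν.real (Set.Iio x) ≤ ν.real Set.univ := measureReal_mono (Set.subset_univ _)
    have h3 : 0 ≤ μ.real (Set.Iio x) := measureReal_nonneg
    have h4 : 0 ≤ ν.real (Set.Iio x) := measureReal_nonneg
    exact abs_le.2 ⟨by linarith, by linarith⟩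
  have hx : |μ.real (Set.Iio x) - ν.real (Set.Iio x)| ≤ kolmogorovDist μ ν := le_ciSup hbdd x
  have h0 : 0 ≤ kolmogorovDist μ ν := (abs_nonneg _).trans hx
  obtain ⟨hx1, hx2⟩ := abs_le.1 hx
  have h1 : μ.real (Set.Iio (x - kolmogorovDist μ ν)) ≤ μ.real (Set.Iio x) :=
    real_Iio_mono μ (by linarith)
  have h2 : μ.real (Set.Iio x) ≤ μ.real (Set.Iio (x + kolmogorovDist μ ν)) :=
    real_Iio_mono μ (by linarith)
  exact ⟨by linarith, by linarith⟩

theorem levyDist_le_kolmogorovDist [IsFiniteMeasure ν] : levyDist μ ν ≤ kolmogorovDist μ ν :=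
  csInf_le ⟨0, fun _ hh => nonneg_of_levy_bounds hh⟩ levy_bounds_kolmogorovDist

theorem le_levyDist [IsFiniteMeasure ν] {c : ℝ} (hc : ∀ h : ℝ, (∀ x : ℝ,
    μ.real (Set.Iio (x - h)) - h ≤ ν.real (Set.Iio x) ∧
      ν.real (Set.Iio x) ≤ μ.real (Set.Iio (x + h)) + h) → c ≤ h) : c ≤ levyDist μ ν :=
  le_csInf ⟨_, levy_bounds_kolmogorovDist⟩ hc

/-- As the density of the semicircle law is at most `1`, an admissible `h` in the Lévy distance to
it bounds the Kolmogorov distance by `2 h`. -/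
theorem abs_sub_semicircle_le (hh : ∀ x : ℝ,
    μ.real (Set.Iio (x - h)) - h ≤ semicircle.real (Set.Iio x) ∧
    semicircle.real (Set.Iio x) ≤ μ.real (Set.Iio (x + h)) + h) (x : ℝ) :
    |μ.real (Set.Iio x) - semicircle.real (Set.Iio x)| ≤ 2 * h := by
  have h0 := nonneg_of_levy_bounds hh
  have h1 := (hh (x + h)).1
  have h2 := (hh (x - h)).2
  rw [add_sub_cancel_right] at h1
  rw [sub_add_cancel] at h2
  have h3 := semicircle_real_Iio_sub_le (x := x) (y := x + h) (by linarith)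
  have h4 := semicircle_real_Iio_sub_le (x := x - h) (y := x) (by linarith)
  exact abs_le.2 ⟨by linarith, by linarith⟩

end Levy

end LowerBound

end FreeProb

theorem proposition2p4 (p q : ℝ) (hp0 : 0 < p) (hp1 : p < 1) (hq : q = 1 - p)
    (hpq : p - q ≠ 0) :
    ∃ c : ℝ, 0 < c ∧
      ∀ μ : MeasureTheory.ProbabilityMeasure ℝ,
        (μ : MeasureTheory.Measure ℝ) {-Real.sqrt (p / q)} = ENNReal.ofReal q →
        (μ : MeasureTheory.Measure ℝ) {Real.sqrt (q / p)} = ENNReal.ofReal p →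
        ∀ n : ℕ, 1 ≤ n →
          FreeProb.kolmogorovDist (FreeProb.freePow (FreeProb.rescale μ n) n)
              FreeProb.semicircle ≥
            FreeProb.levyDist (FreeProb.freePow (FreeProb.rescale μ n) n)
              FreeProb.semicircle ∧
          FreeProb.levyDist (FreeProb.freePow (FreeProb.rescale μ n) n)
              FreeProb.semicircle ≥ c / Real.sqrt n := by
  have hq0 : 0 < q := by linarith
  set s := Real.sqrt (q / p) - Real.sqrt (p / q) with hs
  have hs0 : s ≠ 0 := fun h => hpq (by
    have h1 : q / p = p / q :=
      (Real.sqrt_inj (by positivity) (by positivity)).1 (sub_eq_zero.1 h)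
    rw [div_eq_div_iff hp0.ne' hq0.ne'] at h1
    nlinarith)
  refine ⟨|s| / (8 * (2 + |s|) ^ 2) / (2 * Real.pi), by positivity, fun μ ha hb n hn =>
    ⟨FreeProb.levyDist_le_kolmogorovDist, FreeProb.le_levyDist fun h hh => ?_⟩⟩
  have hμ := FreeProb.isFreeBinomial_rescale hp0 hq0 (by linarith) μ ha hb hn
  obtain ⟨k, rfl⟩ : ∃ k, n = k + 1 := ⟨n - 1, by omega⟩
  have hν := FreeProb.isFreeBinomial_freePow hμ (by positivity) k
  rw [← Nat.cast_succ] at hν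
  have hlow := FreeProb.abs_re_cauchyTransform_I_ge hn hν
  have hup := FreeProb.abs_integral_sub_integral_le _ _ (FreeProb.abs_sub_semicircle_le hh)
  rw [FreeProb.integral_semicircle_div_one_add_sq, sub_zero] at hup
  rw [FreeProb.re_cauchyTransform_I, abs_neg] at hlow
  rw [div_right_comm, div_le_iff₀ (by positivity)]
  linarith
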